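/- Let $R$ be a commutative ring, let $\underline{x} = x_1,\ldots,x_k$ be an ordered sequence of elements of $R$, and let $M$ be an $R$-module. For a positive integer $n$ put $\underline{x}^{(n)} = x_1^n,\ldots,x_k^n$; for a submodule $N \subseteq M$ and $r \in R$ put $N :_M r = \{a \in M : ra \in N\}$. The sequence $\underline{x}$ is called *$M$-proregular* if for all $i = 1,\ldots,k$ and every positive integer $n$ there is an integer $m \ge n$ such that $$(x_1^m,\ldots,x_{i-1}^m)M :_M x_i^m \;\subseteq\; (x_1^n,\ldots,x_{i-1}^n)M :_M x_i^{m-n},$$ equivalently, such that multiplication by $x_i^{m-n}$ induces the zero map $$\bigl((x_1^m,\ldots,x_{i-1}^m)M :_M x_i^m\bigr)/(x_1^m,\ldots,x_{i-1}^m)M \to \bigl((x_1^n,\ldots,x_{i-1}^n)M :_M x_i^n\bigr)/(x_1^n,\ldots,x_{i-1}^n)M.$$ The sequence $\underline{x}$ is called *$M$-weakly proregular* if for all $i > 0$ and every positive integer $n$ there is an integer $m \ge n$ such that the natural homomorphism of Koszul homology modules $$H_i(\underline{x}^{(m)};M) \to H_i(\underline{x}^{(n)};M),$$ induced by the morphism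 of Koszul complexes $K_\bullet(\underline{x}^{(m)};M) \to K_\bullet(\underline{x}^{(n)};M)$, $e_{j_1}\wedge\cdots\wedge e_{j_p} \mapsto (x_{j_1}\cdots x_{j_p})^{m-n}\, e_{j_1}\wedge\cdots\wedge e_{j_p}$, is zero. **Theorem.** If $\underline{x}$ is $M$-proregular, then $\underline{x}$ is $M$-weakly proregular. -/

import Mathlib

open CategoryTheory

noncomputable section

namespace Koszul

universe u v

variable {R : Type u} [CommRing R]

/-- The submodule `N :_M r = {a ∈ M | r a ∈ N}` of `M`. -/
def colon {M : Type v} [AddCommGroup M] [Module R M] (N : Submodule R M) (r : R) :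
    Submodule R M :=
  N.comap (LinearMap.lsmul R M r)

/-- The submodule `(x_1^n, …, x_{i-1}^n) M` of `M`: the ideal generated by the `n`-th powers of
the elements strictly before position `i`, times `M`. -/
def initialPowers (M : Type v) [AddCommGroup M] [Module R M] {k : ℕ} (x : Fin k → R)
    (i : Fin k) (n : ℕ) : Submodule R M :=
  Ideal.span {r : R | ∃ j : Fin k, j < i ∧ r = x j ^ n} • (⊤ : Submodule R M)

/-- The sequence `x` is `M`-proregular: for all `i` and all `n ≥ 1` there is an `m ≥ n` with
`(x_1^m, …, x_{i-1}^m)M :_M x_i^m ⊆ (x_1^n, …, x_{i-1}^n)M :_M x_i^{m-n}`, that is, such that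
multiplication by `x_i^{m-n}` from
`((x_1^m, …, x_{i-1}^m)M :_M x_i^m) / (x_1^m, …, x_{i-1}^m)M` to
`((x_1^n, …, x_{i-1}^n)M :_M x_i^n) / (x_1^n, …, x_{i-1}^n)M` is the zero map. -/
def IsProregular (M : Type v) [AddCommGroup M] [Module R M] {k : ℕ} (x : Fin k → R) : Prop :=
  ∀ i : Fin k, ∀ n : ℕ, 1 ≤ n → ∃ m : ℕ, n ≤ m ∧
    colon (initialPowers M x i m) (x i ^ m) ≤ colon (initialPowers M x i n) (x i ^ (m - n))

/-- The degree `p` part `K_p(x; M) = ⨁_S M e_S` of the Koszul complex, `S` running over the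
subsets of the index set with `p` elements. A function `f` stands for `∑_S f(S) e_S`, where
`e_S = e_{j_1} ∧ ⋯ ∧ e_{j_p}` for `S = {j_1 < ⋯ < j_p}`. -/
abbrev Chains (k p : ℕ) (M : Type v) : Type v :=
  {S : Finset (Fin k) // S.card = p} → M

/-- `S ∪ {j}` for `j ∉ S`. -/
def adjoin {k p : ℕ} (S : {S : Finset (Fin k) // S.card = p}) (j : {j : Fin k // j ∉ S.1}) :
    {S : Finset (Fin k) // S.card = p + 1} :=
  ⟨insert j.1 S.1, by rw [Finset.card_insert_of_notMem j.2, S.2]⟩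

/-- The number of elements of `S` that precede `j`. -/
def before {k : ℕ} (S : Finset (Fin k)) (j : Fin k) : ℕ := (S.filter (· < j)).card

/-- The Koszul differential `K_{p+1}(x; M) → K_p(x; M)`,
`e_{j_0} ∧ ⋯ ∧ e_{j_p} ↦ ∑_s (-1)^s x_{j_s} e_{j_0} ∧ ⋯ ∧ (omit e_{j_s}) ∧ ⋯ ∧ e_{j_p}`:
the coefficient of `e_S` in the image of `f` collects the terms coming from `e_{S ∪ {j}}`,
`j ∉ S`. -/
def differential (M : Type v) [AddCommGroup M] [Module R M] {k : ℕ} (x : Fin k → R) (p : ℕ) :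
    Chains k (p + 1) M →ₗ[R] Chains k p M where
  toFun f := fun S => ∑ j : {j : Fin k // j ∉ S.1},
    ((-1 : R) ^ before S.1 j.1 * x j.1) • f (adjoin S j)
  map_add' f g := by
    funext S
    simp [Finset.sum_add_distrib]
  map_smul' r f := by
    funext S
    simp only [Pi.smul_apply, RingHom.id_apply, Finset.smul_sum]
    refine Finset.sum_congr rfl fun j _ => ?_
    rw [smul_smul, smul_smul, mul_comm]

theorem before_insert {k : ℕ} (S : Finset (Fin k)) {j l : Fin k} (hj : j ∉ S) :
    before (insert j S) l = before S l + if j < l then 1 else 0 := by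
  unfold before
  rw [Finset.filter_insert]
  split_ifs with h
  · rw [Finset.card_insert_of_notMem (by simp [hj])]
  · rfl

theorem differential_comp (M : Type v) [AddCommGroup M] [Module R M] {k : ℕ} (x : Fin k → R)
    (p : ℕ) : differential M x p ∘ₗ differential M x (p + 1) = 0 := by
  refine LinearMap.ext fun f => ?_
  funext S
  simp only [LinearMap.comp_apply, differential, LinearMap.coe_mk, AddHom.coe_mk,
    LinearMap.zero_apply, Pi.zero_apply, Finset.smul_sum]
  rw [Finset.sum_sigma']
  have mem : ∀ a : (j : {j : Fin k // j ∉ S.1}) × {l : Fin k // l ∉ (adjoin S j).1},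
      a.2.1 ≠ a.1.1 ∧ a.2.1 ∉ S.1 := by
    intro a
    have h := a.2.2
    simpa [adjoin] using h
  refine Finset.sum_involution
    (fun a _ => ⟨⟨a.2.1, (mem a).2⟩, ⟨a.1.1, by
      simpa [adjoin] using And.intro (mem a).1.symm a.1.2⟩⟩) ?_ ?_ ?_ ?_
  · rintro a -
    obtain ⟨hne, hS⟩ := mem a
    obtain ⟨⟨j, hj⟩, ⟨l, hl⟩⟩ := a
    dsimp only at hne hS ⊢
    have e : adjoin (adjoin S ⟨l, hS⟩) ⟨j, by simpa [adjoin] using And.intro hne.symm hj⟩ =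
        adjoin (adjoin S ⟨j, hj⟩) ⟨l, hl⟩ := Subtype.ext (Finset.insert_comm _ _ _)
    rw [e, smul_smul, smul_smul, ← add_smul]
    convert zero_smul R _
    change (-1 : R) ^ before S.1 j * x j * ((-1) ^ before (insert j S.1) l * x l) +
      (-1 : R) ^ before S.1 l * x l * ((-1) ^ before (insert l S.1) j * x j) = 0
    rw [before_insert _ hj, before_insert _ hS]
    rcases lt_or_gt_of_ne hne with h | h
    · rw [if_neg h.asymm, if_pos h]; ring
    · rw [if_pos h, if_neg h.asymm]; ring
  · rintro a - - h
    exact (mem a).1 (congrArg (fun b => b.1.1) h)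
  · intro a _
    exact Finset.mem_univ _
  · intro a _
    rfl

/-- The Koszul complex `K_•(x; M)`. -/
def complex (M : Type v) [AddCommGroup M] [Module R M] {k : ℕ} (x : Fin k → R) :
    ChainComplex (ModuleCat.{v} R) ℕ :=
  ChainComplex.of (fun p => ModuleCat.of R (Chains k p M))
    (fun p => ModuleCat.ofHom (differential M x p))
    (fun p => by
      rw [← ModuleCat.ofHom_comp, differential_comp]
      rfl)

/-- The map `e_S ↦ (∏_{j ∈ S} a_j) e_S` in degree `p`. -/
def scale (M : Type v) [AddCommGroup M] [Module R M] {k : ℕ} (a : Fin k → R) (p : ℕ) :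
    Chains k p M →ₗ[R] Chains k p M :=
  LinearMap.pi fun S => (∏ j ∈ S.1, a j) • LinearMap.proj S

theorem scale_comm (M : Type v) [AddCommGroup M] [Module R M] {k : ℕ} (x y a : Fin k → R)
    (h : ∀ j, x j = a j * y j) (p : ℕ) :
    differential M y p ∘ₗ scale M a (p + 1) = scale M a p ∘ₗ differential M x p := by
  refine LinearMap.ext fun f => ?_
  funext S
  simp only [LinearMap.comp_apply, differential, scale, LinearMap.coe_mk, AddHom.coe_mk,
    LinearMap.pi_apply, LinearMap.smul_apply, LinearMap.proj_apply, Finset.smul_sum]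
  refine Finset.sum_congr rfl fun j _ => ?_
  have e : ∏ i ∈ (adjoin S j).1, a i = a j.1 * ∏ i ∈ S.1, a i := Finset.prod_insert j.2
  rw [e, smul_smul, smul_smul, h]
  congr 1
  ring

/-- The natural morphism `K_•(x; M) → K_•(y; M)` for `x_j = a_j y_j`: it is the identity in
degree `0`, and is induced by `e_j ↦ a_j e_j`. -/
def complexMap (M : Type v) [AddCommGroup M] [Module R M] {k : ℕ} (x y a : Fin k → R)
    (h : ∀ j, x j = a j * y j) : complex M x ⟶ complex M y :=
  ChainComplex.ofHom (fun p => ModuleCat.ofHom (scale M a p)) (fun p => by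
    simp only [complex, ChainComplex.of_d]
    exact congrArg ModuleCat.ofHom (scale_comm M x y a h p))

/-- The sequence `x^{(n)} = x_1^n, …, x_k^n`. -/
def powers {k : ℕ} (x : Fin k → R) (n : ℕ) : Fin k → R := fun j => x j ^ n

/-- The natural morphism `K_•(x^{(m)}; M) → K_•(x^{(n)}; M)` for `m ≥ n`, induced by
`e_j ↦ x_j^{m-n} e_j`. -/
def transition (M : Type v) [AddCommGroup M] [Module R M] {k : ℕ} (x : Fin k → R) {m n : ℕ}
    (h : n ≤ m) : complex M (powers x m) ⟶ complex M (powers x n) :=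
  complexMap M (powers x m) (powers x n) (powers x (m - n)) fun j => by
    simp only [powers]
    rw [← pow_add, Nat.sub_add_cancel h]

/-- The sequence `x` is `M`-weakly proregular: for all `i > 0` and all `n ≥ 1` there is an
`m ≥ n` such that the natural map `H_i(x^{(m)}; M) → H_i(x^{(n)}; M)` is zero. -/
def IsWeaklyProregular (M : Type v) [AddCommGroup M] [Module R M] {k : ℕ} (x : Fin k → R) :
    Prop :=
  ∀ i : ℕ, 0 < i → ∀ n : ℕ, 1 ≤ n → ∃ (m : ℕ) (h : n ≤ m),
    HomologicalComplex.homologyMap (transition M x h) i = 0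

end Koszul

end

/-! The sequence is lengthened one element at a time, the transition maps for the shorter sequence
being pro-zero on homology in positive degrees by induction. Let `e_i` be the new element and let
`z` be a cycle. Contracting by `e_i` gives a cycle for the shorter sequence. Its degree-zero part is
controlled by proregularity and the rest by induction, so that after one transition the contraction
is a boundary `∂ w`. Now `z + ∂ (e_i ∧ w)` no longer involves `e_i`, and a second transition makes
it a boundary by induction. -/

noncomputable section

namespace Koszul

universe u v

variable {R : Type u} [CommRing R] {M : Type v} [AddCommGroup M] [Module R M] {k : ℕ}

variable (R M) in
/-- Contraction of inhomogeneous chains `∑_S f(S) e_S` against the dual basis vector of `e_j`. The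
sign is that of moving `e_j` to the front, so contractions anticommute. -/
def contract (j : Fin k) : (Finset (Fin k) → M) →ₗ[R] (Finset (Fin k) → M) :=
  LinearMap.pi fun S =>
    if j ∈ S then 0 else (-1 : R) ^ before S j • LinearMap.proj (insert j S)

theorem contract_apply_of_mem {j : Fin k} {S : Finset (Fin k)} (h : j ∈ S)
    (f : Finset (Fin k) → M) : contract R M j f S = 0 := by
  simp [contract, h]

theorem contract_apply_of_notMem {j : Fin k} {S : Finset (Fin k)} (h : j ∉ S)
    (f : Finset (Fin k) → M) :
    contract R M j f S = (-1 : R) ^ before S j • f (insert j S) := by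
  simp [contract, h]

theorem contract_apply_empty (j : Fin k) (f : Finset (Fin k) → M) :
    contract R M j f ∅ = f {j} := by
  simp [contract_apply_of_notMem (Finset.notMem_empty j), before]

theorem contract_contract (i j : Fin k) (f : Finset (Fin k) → M) :
    contract R M i (contract R M j f) = -contract R M j (contract R M i f) := by
  funext S
  rw [Pi.neg_apply]
  by_cases hi : i ∈ S
  · by_cases hj : j ∈ S
    · simp only [contract_apply_of_mem hi, contract_apply_of_mem hj, neg_zero]
    · rw [contract_apply_of_mem hi, contract_apply_of_notMem hj,
        contract_apply_of_mem (Finset.mem_insert_of_mem hi), smul_zero, neg_zero]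
  by_cases hj : j ∈ S
  · rw [contract_apply_of_notMem hi, contract_apply_of_mem hj,
      contract_apply_of_mem (Finset.mem_insert_of_mem hj), smul_zero, neg_zero]
  obtain rfl | hij := eq_or_ne i j
  · rw [contract_apply_of_notMem hi, contract_apply_of_mem (Finset.mem_insert_self _ _),
      smul_zero, neg_zero]
  rw [contract_apply_of_notMem hi, contract_apply_of_notMem hj,
    contract_apply_of_notMem (by simp [hij.symm, hj]),
    contract_apply_of_notMem (by simp [hij, hi]), Finset.insert_comm j i, smul_smul, smul_smul,
    ← neg_smul, before_insert S hi, before_insert S hj]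
  congr 1
  rcases lt_or_gt_of_ne hij with h | h <;> rw [if_pos h, if_neg h.asymm] <;> ring

/-- The Koszul differential on inhomogeneous chains. -/
def totalDifferential (M : Type v) [AddCommGroup M] [Module R M] (y : Fin k → R) :
    (Finset (Fin k) → M) →ₗ[R] (Finset (Fin k) → M) :=
  ∑ j, y j • contract R M j

theorem totalDifferential_eq_sum (y : Fin k → R) (f : Finset (Fin k) → M) :
    totalDifferential M y f = ∑ j, y j • contract R M j f := by
  simp [totalDifferential]

theorem totalDifferential_apply_empty (y : Fin k → R) (f : Finset (Fin k) → M) :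
    totalDifferential M y f ∅ = ∑ j, y j • f {j} := by
  simp [totalDifferential_eq_sum, contract_apply_empty]

theorem contract_totalDifferential (i : Fin k) (y : Fin k → R) (f : Finset (Fin k) → M) :
    contract R M i (totalDifferential M y f) = -totalDifferential M y (contract R M i f) := by
  simp only [totalDifferential_eq_sum, map_sum, map_smul, contract_contract i, smul_neg,
    Finset.sum_neg_distrib]

/-- The map `e_S ↦ (∏_{j ∈ S} a_j) e_S` on inhomogeneous chains. -/
def totalScale (M : Type v) [AddCommGroup M] [Module R M] (a : Fin k → R) :
    (Finset (Fin k) → M) →ₗ[R] (Finset (Fin k) → M) :=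
  LinearMap.pi fun S => (∏ j ∈ S, a j) • LinearMap.proj S

theorem totalScale_apply (a : Fin k → R) (f : Finset (Fin k) → M) (S : Finset (Fin k)) :
    totalScale M a f S = (∏ j ∈ S, a j) • f S := rfl

theorem totalScale_mul (a b : Fin k → R) (f : Finset (Fin k) → M) :
    totalScale M (a * b) f = totalScale M a (totalScale M b f) := by
  funext S
  simp only [totalScale_apply, Pi.mul_apply, Finset.prod_mul_distrib, smul_smul]

theorem contract_totalScale (i : Fin k) (a : Fin k → R) (f : Finset (Fin k) → M) :
    contract R M i (totalScale M a f) = a i • totalScale M a (contract R M i f) := by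
  funext S
  rw [Pi.smul_apply, totalScale_apply]
  by_cases h : i ∈ S
  · simp only [contract_apply_of_mem h, smul_zero]
  · simp only [contract_apply_of_notMem h, totalScale_apply, Finset.prod_insert h, smul_smul]
    congr 1
    ring

theorem totalDifferential_totalScale (a y : Fin k → R) (f : Finset (Fin k) → M) :
    totalDifferential M y (totalScale M a f) =
      totalScale M a (totalDifferential M (a * y) f) := by
  simp only [totalDifferential_eq_sum, map_sum, map_smul, contract_totalScale, smul_smul,
    Pi.mul_apply, mul_comm]

/-- The exterior product `e_i ∧ f`. -/
def wedge (R : Type u) [CommRing R] {M : Type v} [AddCommGroup M] [Module R M] (i : Fin k)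
    (f : Finset (Fin k) → M) : Finset (Fin k) → M :=
  fun S => if i ∈ S then (-1 : R) ^ before (S.erase i) i • f (S.erase i) else 0

/-- The homogeneous component of degree `p` of an inhomogeneous chain. -/
def component (R : Type u) [CommRing R] (M : Type v) [AddCommGroup M] [Module R M] (k p : ℕ) :
    (Finset (Fin k) → M) →ₗ[R] Chains k p M :=
  LinearMap.funLeft R M Subtype.val

theorem ext_component {f g : Finset (Fin k) → M}
    (h : ∀ p, component R M k p f = component R M k p g) : f = g :=
  funext fun S => congrFun (h S.card) ⟨S, rfl⟩

theorem component_totalDifferential (y : Fin k → R) (p : ℕ) (f : Finset (Fin k) → M) :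
    component R M k p (totalDifferential M y f) =
      differential M y p (component R M k (p + 1) f) := by
  funext S
  change totalDifferential M y f S.1 =
    ∑ j : {j : Fin k // j ∉ S.1}, ((-1 : R) ^ before S.1 j.1 * y j.1) • f (insert j.1 S.1)
  rw [totalDifferential_eq_sum, Finset.sum_apply, ← Finset.sum_subtype (p := (· ∉ S.1)) (S.1)ᶜ
    (by simp) fun j => ((-1 : R) ^ before S.1 j * y j) • f (insert j S.1)]
  refine (Finset.sum_subset_zero_on_sdiff (Finset.subset_univ _) (fun j hj => ?_)
    fun j hj => ?_).symm
  · rw [Pi.smul_apply, contract_apply_of_mem (by simpa using hj), smul_zero]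
  · rw [Pi.smul_apply, contract_apply_of_notMem (by simpa using hj), smul_smul, mul_comm]

theorem component_totalScale (a : Fin k → R) (p : ℕ) (f : Finset (Fin k) → M) :
    component R M k p (totalScale M a f) = scale M a p (component R M k p f) := rfl

theorem totalDifferential_totalDifferential (y : Fin k → R) (f : Finset (Fin k) → M) :
    totalDifferential M y (totalDifferential M y f) = 0 := by
  refine ext_component (R := R) fun p => ?_
  rw [component_totalDifferential, component_totalDifferential, map_zero]
  exact LinearMap.congr_fun (differential_comp M y p) _

theorem exists_component_eq {p : ℕ} (z : Chains k p M) :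
    ∃ f : Finset (Fin k) → M, component R M k p f = z ∧
      ∀ q, q ≠ p → component R M k q f = 0 := by
  refine ⟨Function.extend Subtype.val z 0, funext fun S => Subtype.val_injective.extend_apply z 0 S,
    fun q hq => funext fun S => Function.extend_apply' _ _ _ ?_⟩
  rintro ⟨T, hT⟩
  exact hq (by rw [← S.2, ← hT, T.2])

section Support

variable (R M) in
/-- The chains of the Koszul complex on the subsequence indexed by `A`. -/
def chainsOn (A : Set (Fin k)) : Submodule R (Finset (Fin k) → M) where
  carrier := {f | ∀ S : Finset (Fin k), ¬(S : Set (Fin k)) ⊆ A → f S = 0}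
  add_mem' hf hg S hS := by rw [Pi.add_apply, hf S hS, hg S hS, add_zero]
  zero_mem' _ _ := rfl
  smul_mem' r f hf S hS := by rw [Pi.smul_apply, hf S hS, smul_zero]

variable (R M) in
/-- The chains on the subsequence indexed by `A` without component in degree zero. -/
def posChainsOn (A : Set (Fin k)) : Submodule R (Finset (Fin k) → M) :=
  chainsOn R M A ⊓ LinearMap.ker (LinearMap.proj ∅)

variable {A B : Set (Fin k)} {f : Finset (Fin k) → M}

theorem posChainsOn_mono (h : A ⊆ B) : posChainsOn R M A ≤ posChainsOn R M B :=
  fun _ hf => ⟨fun S hS => hf.1 S fun hSA => hS (hSA.trans h), hf.2⟩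

theorem contract_mem_chainsOn {i : Fin k} (hf : f ∈ chainsOn R M (insert i A)) :
    contract R M i f ∈ chainsOn R M A := by
  intro S hS
  by_cases hi : i ∈ S
  · exact contract_apply_of_mem hi f
  · rw [contract_apply_of_notMem hi, hf, smul_zero]
    rw [Finset.coe_insert, Set.insert_subset_insert_iff (by simpa using hi)]
    exact hS

theorem mem_chainsOn_of_contract_eq_zero {i : Fin k} (hf : f ∈ chainsOn R M (insert i A))
    (h : contract R M i f = 0) : f ∈ chainsOn R M A := by
  intro S hS
  by_cases hi : i ∈ S
  · have hSi := congrFun h (S.erase i)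
    rw [contract_apply_of_notMem (Finset.notMem_erase i S), Finset.insert_erase hi] at hSi
    exact (isUnit_neg_one.pow _).smul_eq_zero.1 hSi
  · exact hf S fun hS' => hS ((Set.subset_insert_iff_of_notMem (by simpa using hi)).1 hS')

theorem totalDifferential_mem_chainsOn (y : Fin k → R) (hf : f ∈ chainsOn R M A) :
    totalDifferential M y f ∈ chainsOn R M A := by
  rw [totalDifferential_eq_sum]
  refine sum_mem fun j _ => Submodule.smul_mem _ _ (contract_mem_chainsOn ?_)
  exact fun S hS => hf S fun hSA => hS (hSA.trans (Set.subset_insert j A))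

theorem totalScale_mem_posChainsOn (a : Fin k → R) (hf : f ∈ posChainsOn R M A) :
    totalScale M a f ∈ posChainsOn R M A := by
  refine ⟨fun S hS => ?_, ?_⟩
  · rw [totalScale_apply, hf.1 S hS, smul_zero]
  · simpa [totalScale_apply] using hf.2

theorem wedge_mem_posChainsOn (i : Fin k) (hf : f ∈ chainsOn R M A) :
    wedge R i f ∈ posChainsOn R M (insert i A) := by
  refine ⟨fun S hS => ?_, show wedge R i f ∅ = 0 from if_neg (Finset.notMem_empty i)⟩
  unfold wedge
  split_ifs with hi
  · rw [hf, smul_zero]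
    rwa [Finset.coe_erase, Set.sdiff_singleton_subset_iff]
  · rfl

theorem contract_wedge {i : Fin k} (hi : i ∉ A) (hf : f ∈ chainsOn R M A) :
    contract R M i (wedge R i f) = f := by
  funext S
  by_cases h : i ∈ S
  · rw [contract_apply_of_mem h, hf S fun hS => hi (hS h)]
  · rw [contract_apply_of_notMem h, wedge, if_pos (Finset.mem_insert_self i S),
      Finset.erase_insert h, smul_smul, ← mul_pow, neg_one_mul, neg_neg, one_pow, one_smul]

theorem totalDifferential_wedge_apply_empty (i : Fin k) (y : Fin k → R)
    (f : Finset (Fin k) → M) : totalDifferential M y (wedge R i f) ∅ = y i • f ∅ := by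
  rw [totalDifferential_apply_empty, Finset.sum_eq_single i]
  · simp [wedge, before]
  · intro j _ hj
    simp [wedge, hj.symm]
  · simp

theorem add_totalDifferential_wedge_mem_posChainsOn {i : Fin k} (hi : i ∉ A) (y : Fin k → R)
    {z w : Finset (Fin k) → M} (hz : z ∈ posChainsOn R M (insert i A))
    (hw : w ∈ posChainsOn R M A) (h : totalDifferential M y w = contract R M i z) :
    z + totalDifferential M y (wedge R i w) ∈ posChainsOn R M A := by
  have hwedge := (wedge_mem_posChainsOn i hw.1).1
  refine ⟨mem_chainsOn_of_contract_eq_zero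
    (add_mem hz.1 (totalDifferential_mem_chainsOn y hwedge)) ?_, ?_⟩
  · rw [map_add, contract_totalDifferential, contract_wedge hi hw.1, h, add_neg_cancel]
  · have hz0 : z ∅ = 0 := hz.2
    have hw0 : w ∅ = 0 := hw.2
    change z ∅ + totalDifferential M y (wedge R i w) ∅ = 0
    rw [totalDifferential_wedge_apply_empty, hz0, hw0, smul_zero, add_zero]

end Support

/-- The submodule `(y_j : j ∈ A) M` of `M`. -/
def multiplesOn (M : Type v) [AddCommGroup M] [Module R M] (y : Fin k → R) (A : Set (Fin k)) :
    Submodule R M :=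
  Ideal.span (y '' A) • ⊤

theorem initialPowers_eq_multiplesOn (x : Fin k → R) (i : Fin k) (n : ℕ) :
    initialPowers M x i n = multiplesOn M (powers x n) (Set.Iio i) := by
  unfold initialPowers multiplesOn
  congr 2
  ext r
  simp [powers, eq_comm]

theorem exists_totalDifferential_apply_empty_eq {y : Fin k → R} {A : Set (Fin k)} {b : M}
    (hb : b ∈ multiplesOn M y A) :
    ∃ w ∈ posChainsOn R M A, totalDifferential M y w ∅ = b := by
  suffices multiplesOn M y A ≤
      (posChainsOn R M A).map (LinearMap.proj ∅ ∘ₗ totalDifferential M y) from this hb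
  rw [multiplesOn, Submodule.span_smul_eq, Submodule.set_smul_le_iff]
  rintro _ c ⟨j, hj, rfl⟩ -
  refine ⟨Pi.single {j} c, ⟨fun S hS => ?_, ?_⟩, ?_⟩
  · rw [Pi.single_eq_of_ne]
    rintro rfl
    exact hS (by simpa using hj)
  · exact Pi.single_eq_of_ne (M := fun _ => M) (Finset.singleton_ne_empty j).symm c
  · rw [LinearMap.comp_apply, LinearMap.proj_apply, totalDifferential_apply_empty,
      Finset.sum_eq_single j (fun l _ hl => by simp [hl]) (by simp), Pi.single_eq_same]

theorem apply_singleton_mem_colon {y : Fin k → R} {A : Set (Fin k)} {i : Fin k}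
    {z : Finset (Fin k) → M} (hz : z ∈ chainsOn R M (insert i A))
    (hdz : totalDifferential M y z = 0) : z {i} ∈ colon (multiplesOn M y A) (y i) := by
  have h0 := congrFun hdz ∅
  rw [totalDifferential_apply_empty, ← Finset.add_sum_erase _ _ (Finset.mem_univ i)] at h0
  change y i • z {i} ∈ multiplesOn M y A
  rw [eq_neg_of_add_eq_zero_left h0]
  refine neg_mem (sum_mem fun j hj => ?_)
  by_cases hjA : j ∈ A
  · exact Submodule.smul_mem_smul (Ideal.subset_span ⟨j, hjA, rfl⟩) Submodule.mem_top
  · rw [hz {j} (by simpa [hjA] using Finset.ne_of_mem_erase hj), smul_zero]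
    exact zero_mem _

section KillsHomology

/-- The map `K_•(a y; M) → K_•(y; M)`, `e_S ↦ (∏_{j ∈ S} a_j) e_S`, of Koszul complexes on the
subsequences indexed by `A` is zero on homology in positive degrees. -/
def KillsHomologyOn (M : Type v) [AddCommGroup M] [Module R M] (A : Set (Fin k))
    (a y : Fin k → R) : Prop :=
  ∀ z ∈ posChainsOn R M A, totalDifferential M (a * y) z = 0 →
    ∃ w ∈ posChainsOn R M A, totalDifferential M y w = totalScale M a z

theorem killsHomologyOn_empty (a y : Fin k → R) : KillsHomologyOn M ∅ a y := by
  intro z hz _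
  have hz0 : z = 0 := funext fun S => by
    rcases S.eq_empty_or_nonempty with rfl | hS
    · exact hz.2
    · exact hz.1 S (by simpa [Set.subset_empty_iff] using hS.ne_empty)
  exact ⟨0, zero_mem _, by rw [hz0, map_zero, map_zero]⟩

variable {A : Set (Fin k)} {i : Fin k} {a b c y : Fin k → R} {z : Finset (Fin k) → M}

theorem KillsHomologyOn.exists_totalDifferential_eq_totalScale_of_contract
    (ha : KillsHomologyOn M A a y) (hi : i ∉ A) (hz : z ∈ posChainsOn R M (insert i A))
    (hdz : totalDifferential M (a * y) z = 0)
    (hcz : ∃ w ∈ posChainsOn R M A, totalDifferential M (a * y) w = contract R M i z) :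
    ∃ w ∈ posChainsOn R M (insert i A), totalDifferential M y w = totalScale M a z := by
  obtain ⟨w, hw, hdw⟩ := hcz
  obtain ⟨v, hv, hdv⟩ := ha _ (add_totalDifferential_wedge_mem_posChainsOn hi _ hz hw hdw)
    (by rw [map_add, hdz, totalDifferential_totalDifferential, add_zero])
  refine ⟨v - totalScale M a (wedge R i w), sub_mem (posChainsOn_mono (Set.subset_insert i A) hv)
    (totalScale_mem_posChainsOn a (wedge_mem_posChainsOn i hw.1)), ?_⟩
  rw [map_sub, hdv, totalDifferential_totalScale, map_add, add_sub_cancel_right]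

theorem KillsHomologyOn.exists_totalDifferential_eq_totalScale_of_apply_empty
    (hb : KillsHomologyOn M A b y) (hz : z ∈ chainsOn R M A)
    (hdz : totalDifferential M (b * y) z = 0) (hz0 : z ∅ ∈ multiplesOn M (b * y) A) :
    ∃ w ∈ posChainsOn R M A, totalDifferential M y w = totalScale M b z := by
  obtain ⟨w, hw, hw0⟩ := exists_totalDifferential_apply_empty_eq hz0
  obtain ⟨v, hv, hdv⟩ := hb (z - totalDifferential M (b * y) w)
    ⟨sub_mem hz (totalDifferential_mem_chainsOn _ hw.1), sub_eq_zero.2 hw0.symm⟩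
    (by rw [map_sub, hdz, totalDifferential_totalDifferential, sub_zero])
  refine ⟨v + totalScale M b w, add_mem hv (totalScale_mem_posChainsOn b hw), ?_⟩
  rw [map_add, hdv, totalDifferential_totalScale, map_sub, sub_add_cancel]

theorem KillsHomologyOn.exists_totalDifferential_eq_contract_totalScale
    (hb : KillsHomologyOn M A b y) (hz : z ∈ posChainsOn R M (insert i A))
    (hdz : totalDifferential M (c * (b * y)) z = 0)
    (hc : colon (multiplesOn M (c * (b * y)) A) ((c * (b * y)) i) ≤
      colon (multiplesOn M (b * y) A) (c i)) :
    ∃ w ∈ posChainsOn R M A,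
      totalDifferential M y w = contract R M i (totalScale M b (totalScale M c z)) := by
  have hcz := totalScale_mem_posChainsOn c hz
  obtain ⟨w, hw, hdw⟩ := hb.exists_totalDifferential_eq_totalScale_of_apply_empty
    (contract_mem_chainsOn hcz.1)
    (by rw [← neg_eq_zero, ← contract_totalDifferential, totalDifferential_totalScale, hdz,
      map_zero, map_zero])
    (by
      have hmem : c i • z {i} ∈ multiplesOn M (b * y) A := hc (apply_singleton_mem_colon hz.1 hdz)
      simpa [contract_apply_empty, totalScale_apply] using hmem)
  exact ⟨b i • w, Submodule.smul_mem _ _ hw, by rw [map_smul, hdw, contract_totalScale i b]⟩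

theorem KillsHomologyOn.insert (hi : i ∉ A) (ha : KillsHomologyOn M A a y)
    (hb : KillsHomologyOn M A b (a * y))
    (hc : colon (multiplesOn M (c * (b * (a * y))) A) ((c * (b * (a * y))) i) ≤
      colon (multiplesOn M (b * (a * y)) A) (c i)) :
    KillsHomologyOn M (insert i A) (a * (b * c)) y := by
  intro z hz hdz
  have hmul : a * (b * c) * y = c * (b * (a * y)) := by ring
  rw [hmul] at hdz
  rw [totalScale_mul, totalScale_mul]
  refine ha.exists_totalDifferential_eq_totalScale_of_contract hi
    (totalScale_mem_posChainsOn b (totalScale_mem_posChainsOn c hz)) ?_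
    (hb.exists_totalDifferential_eq_contract_totalScale hz hdz hc)
  rw [totalDifferential_totalScale, totalDifferential_totalScale, hdz, map_zero, map_zero]

end KillsHomology

section Proregular

variable {x : Fin k → R}

theorem powers_add (x : Fin k → R) (m n : ℕ) : powers x (m + n) = powers x m * powers x n :=
  funext fun j => pow_add (x j) m n

theorem IsProregular.exists_colon_le (hx : IsProregular M x) (i : Fin k) {n : ℕ} (hn : 1 ≤ n) :
    ∃ s, colon (multiplesOn M (powers x (s + n)) (Set.Iio i)) (powers x (s + n) i) ≤
      colon (multiplesOn M (powers x n) (Set.Iio i)) (powers x s i) := by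
  obtain ⟨m, hnm, hm⟩ := hx i n hn
  obtain ⟨s, rfl⟩ := Nat.exists_eq_add_of_le' hnm
  rw [initialPowers_eq_multiplesOn, initialPowers_eq_multiplesOn, Nat.add_sub_cancel] at hm
  exact ⟨s, hm⟩

theorem IsProregular.exists_killsHomologyOn_initial (hx : IsProregular M x) {i : ℕ} (hi : i ≤ k)
    {n : ℕ} (hn : 1 ≤ n) :
    ∃ s, KillsHomologyOn M {j : Fin k | (j : ℕ) < i} (powers x s) (powers x n) := by
  induction i generalizing n with
  | zero =>
    simp only [Nat.not_lt_zero, Set.ofPred_false]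
    exact ⟨0, killsHomologyOn_empty _ _⟩
  | succ i ih =>
    let i' : Fin k := ⟨i, hi⟩
    have hinsert : {j : Fin k | (j : ℕ) < i + 1} = insert i' (Set.Iio i') := by
      ext j
      change (j : ℕ) < i + 1 ↔ j = i' ∨ (j : ℕ) < i
      rw [Fin.ext_iff, Nat.lt_succ_iff, le_iff_eq_or_lt]
    obtain ⟨s, hs⟩ := ih (Nat.le_of_succ_le hi) hn
    obtain ⟨t, ht⟩ := ih (Nat.le_of_succ_le hi) (n := s + n) (by omega)
    obtain ⟨u, hu⟩ := hx.exists_colon_le i' (n := t + (s + n)) (by omega)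
    simp only [powers_add] at ht hu
    refine ⟨s + (t + u), ?_⟩
    rw [hinsert, powers_add, powers_add]
    exact KillsHomologyOn.insert Set.self_notMem_Iio hs ht hu

theorem KillsHomologyOn.exists_differential_eq {a y : Fin k → R}
    (h : KillsHomologyOn M Set.univ a y) {p : ℕ} {z : Chains k (p + 1) M}
    (hz : differential M (a * y) p z = 0) :
    ∃ w, differential M y (p + 1) w = scale M a (p + 1) z := by
  obtain ⟨f, rfl, hf⟩ := exists_component_eq (R := R) z
  have hpos : f ∈ posChainsOn R M Set.univ :=
    ⟨fun S hS => (hS (Set.subset_univ _)).elim,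
      congrFun (hf 0 (Nat.succ_ne_zero p).symm) ⟨∅, Finset.card_empty⟩⟩
  have hdf : totalDifferential M (a * y) f = 0 := ext_component (R := R) fun q => by
    rw [component_totalDifferential, map_zero]
    obtain rfl | hq := eq_or_ne q p
    · exact hz
    · rw [hf (q + 1) (by omega), map_zero]
  obtain ⟨w, -, hw⟩ := h f hpos hdf
  exact ⟨component R M k (p + 2) w, by
    rw [← component_totalDifferential, hw, component_totalScale]⟩

theorem IsProregular.exists_differential_eq (hx : IsProregular M x) {n : ℕ} (hn : 1 ≤ n) :
    ∃ m, n ≤ m ∧ ∀ (p : ℕ) (z : Chains k (p + 1) M), differential M (powers x m) p z = 0 →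
      ∃ w, differential M (powers x n) (p + 1) w = scale M (powers x (m - n)) (p + 1) z := by
  obtain ⟨s, hs⟩ := hx.exists_killsHomologyOn_initial le_rfl hn
  have huniv : {j : Fin k | (j : ℕ) < k} = Set.univ := Set.eq_univ_of_forall fun j => j.2
  rw [huniv] at hs
  refine ⟨s + n, Nat.le_add_left n s, fun p z hz => ?_⟩
  rw [Nat.add_sub_cancel]
  rw [powers_add] at hz
  exact hs.exists_differential_eq hz

end Proregular

end Koszul

end

theorem homologyMap_eq_zero_of_exists_boundary {R : Type*} [Ring R] {ι : Type*}
    {c : ComplexShape ι} {K L : HomologicalComplex (ModuleCat R) c} (φ : K ⟶ L) (i j l : ι)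
    (h : ∀ z : K.X j, K.d j l z = 0 → ∃ w : L.X i, L.d i j w = φ.f j z) :
    HomologicalComplex.homologyMap φ j = 0 := by
  rw [← cancel_epi (K.homologyπ j), HomologicalComplex.homologyπ_naturality, Limits.comp_zero]
  ext z
  obtain ⟨w, hw⟩ := h (K.iCycles j z) (by
    rw [← ModuleCat.comp_apply, HomologicalComplex.iCycles_d]; rfl)
  have hz : HomologicalComplex.cyclesMap φ j z = L.toCycles i j w := by
    apply (ModuleCat.mono_iff_injective (L.iCycles j)).1 inferInstance
    rw [← ModuleCat.comp_apply, ← ModuleCat.comp_apply, HomologicalComplex.cyclesMap_i,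
      HomologicalComplex.toCycles_i]
    exact hw.symm
  rw [ModuleCat.comp_apply, hz, ← ModuleCat.comp_apply,
    HomologicalComplex.toCycles_comp_homologyπ]
  rfl

theorem theorem2p4 {R : Type*} [CommRing R] {M : Type*} [AddCommGroup M] [Module R M]
    {k : ℕ} (x : Fin k → R) (hx : Koszul.IsProregular M x) :
    Koszul.IsWeaklyProregular M x := by
  intro i hi n hn
  obtain ⟨p, rfl⟩ := Nat.exists_eq_succ_of_ne_zero hi.ne'
  obtain ⟨m, hnm, hm⟩ := hx.exists_differential_eq hn
  refine ⟨m, hnm,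
    homologyMap_eq_zero_of_exists_boundary _ (p + 1 + 1) (p + 1) p fun z hz => ?_⟩
  simp only [Koszul.complex, ChainComplex.of_d] at hz ⊢
  exact hm p z hz
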